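/- Let $\mathbb{U}=\{z\in\mathbb{C}:|z|<1\}$ and let $\mathcal{A}$ be the class of functions $f(z)=z+\sum_{n\ge2}a_nz^n$ analytic in $\mathbb{U}$. For $\delta\ge1$ let $$f_\delta(z)=\int_0^z\Big(\frac{1+r}{1-r}\Big)^{\delta}\frac{dr}{1-r^2}=z+\sum_{n\ge2}b_n(\delta)z^n,\qquad h_\delta(z)=(f*f_\delta)(z)=z+\sum_{n\ge2}a_nb_n(\delta)z^n .$$ For $t\in(1/2,1)$ put $G(t,z)=1/(1-2tz+z^2)$. A function $h_\delta=f*f_\delta$, with $f\in\mathcal{A}$, belongs to $\mathcal{B}_\sigma^\delta(t)$ (the case $\lambda=\mu=1$ of $\mathcal{N}_\sigma^{\mu,\delta}(\lambda,t)$) if it is bi-univalent, i.e. $h_\delta$ is univalent in $\mathbb{U}$ and its inverse near $0$ extends to a univalent analytic function $k_\delta=h_\delta^{-1}$ on $\mathbb{U}$, and if $h_\delta'\prec G(t,\cdot)$ and $k_\delta'\prec G(t,\cdot)$ in $\mathbb{U}$. Here $p\prec q$ means $p=q\circ w$ on $\mathbb U$ for some analytic $w:\mathbb{U}\to\mathbb{U}$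 with $w(0)=0$. Let $U_n$ be the Chebyshev polynomials of the second kind, so $U_1(t)=2t$, $U_2(t)=4t^2-1$, $U_3(t)=8t^3-4t$, and let $$\Omega_{\lambda,\mu,\delta}(t)=18(2\delta^2+1)^2(\lambda+\mu)^3U_3(t)-U_1^3(t)(3\lambda+\mu)\big(3(2\delta^2+1)^2(\mu^2+3\mu-4)+54\delta(\delta^3+2\delta)\big),$$ $$\begin{aligned}\chi_1(\lambda,\mu,\delta;t)={}&(2\lambda+\mu)^2U_1(t)\,|\Omega_{\lambda,\mu,\delta}(t)|\\&+18(\lambda+\mu)^3\big(3\delta(\delta^3+2\delta)(\lambda+\mu)(3\lambda+\mu)-(2\delta^2+1)^2(2\lambda+\mu)^2\big)U_1^2(t)\\&-9(\lambda+\mu)^2(2\lambda+\mu)U_1(t)\big((3\lambda+\mu)(8\delta^4-4\delta^2+5)U_1^2(t)+4(2\delta^2+1)^2(2\lambda+\mu)(\lambda+\mu)U_2(t)\big).\end{aligned}$$ Then for every $\delta\ge1$ the equation $\chi_1(1,1,\delta;t)=0$ has exactly one root $t_0=t_0(\delta)$ in $(1/2,1)$, and for every $t\in(1/2,1)$ and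 every $f\in\mathcal A$ with $h_\delta=f*f_\delta\in\mathcal{B}_\sigma^\delta(t)$, $$|a_2a_4-a_3^2|\le\begin{cases}\varphi(2^-,t),&\tfrac12<t\le t_0,\\ \varphi(c_0,t),&t_0<t<1,\end{cases}$$ where $$\varphi(2^-,t)=\frac{3t^2\big((2\delta^2+1)^2-t^2(5\delta^4+2\delta^2+2)\big)}{(\delta^2+2)(2\delta^3+\delta)^2},$$ $$\varphi(c_0,t)=\frac{4t^2}{(2\delta^2+1)^2}-\frac{t\,\big(3(2\delta^2+1)^2+t(4\delta^4+20\delta^2-3)-t^2(64\delta^4+40\delta^2+22)\big)^2}{8\,\delta(2\delta^2+1)^2(\delta^3+2\delta)\,D(t)},$$ $$D(t)=3(2\delta^2+1)^2+t(-4\delta^4+4\delta^2-3)-t^2(64\delta^4+40\delta^2+22)+6t\,\big|t^2(5\delta^4+2\delta^2+2)-(2\delta^2+1)^2\big|.$$ -/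

import Mathlib

open Set Filter Topology Metric

noncomputable section

/-- The class `𝒜`: functions analytic in the open unit disc with `f 0 = 0` and `f' 0 = 1`. -/
def InClassA (f : ℂ → ℂ) : Prop :=
  DifferentiableOn ℂ f (ball 0 1) ∧ f 0 = 0 ∧ deriv f 0 = 1

/-- The `n`-th Taylor coefficient of `f` at the origin. -/
def taylorCoeff (f : ℂ → ℂ) (n : ℕ) : ℂ :=
  iteratedDeriv n f 0 / (n.factorial : ℂ)

/-- The Hadamard product (convolution) of two power series, as a function. -/
def hadamardProd (f g : ℂ → ℂ) (z : ℂ) : ℂ :=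
  ∑' n : ℕ, taylorCoeff f n * taylorCoeff g n * z ^ n

/-- `f_δ(z) = ∫₀ᶻ ((1 + r) / (1 - r)) ^ δ * (1 / (1 - r ^ 2)) dr`, the integral being taken along
the segment `r = s * z`, `0 ≤ s ≤ 1` (principal branch: `(1 + r) / (1 - r)` has positive real part
in the unit disc). -/
def fDelta (δ : ℝ) (z : ℂ) : ℂ :=
  ∫ s in (0 : ℝ)..1,
    (((1 + (s : ℂ) * z) / (1 - (s : ℂ) * z)) ^ (δ : ℂ) * (1 / (1 - ((s : ℂ) * z) ^ 2))) * z

/-- The function `h_δ = f * f_δ`. -/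
def hDelta (δ : ℝ) (f : ℂ → ℂ) : ℂ → ℂ :=
  hadamardProd f (fDelta δ)

/-- `k` is the inverse `h⁻¹` as a univalent function in the unit disc: `k` is analytic and injective
there and inverts `h` near the origin (so `k` is the analytic continuation of the local inverse,
and is unique on the disc). -/
def IsUnivalentInverse (h k : ℂ → ℂ) : Prop :=
  DifferentiableOn ℂ k (ball 0 1) ∧ InjOn k (ball 0 1) ∧ ∀ᶠ z in 𝓝 (0 : ℂ), k (h z) = z

/-- The class `σ` of bi-univalent functions. -/
def BiUnivalent (h : ℂ → ℂ) : Prop :=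
  InClassA h ∧ InjOn h (ball 0 1) ∧ ∃ k, IsUnivalentInverse h k

/-- `p ≺ q` in the unit disc: `p = q ∘ w` for a Schwarz function `w`. -/
def Subordinate (p q : ℂ → ℂ) : Prop :=
  ∃ w : ℂ → ℂ, DifferentiableOn ℂ w (ball 0 1) ∧ w 0 = 0 ∧
    ∀ z ∈ ball (0 : ℂ) 1, ‖w z‖ < 1 ∧ p z = q (w z)

/-- The generating function `G(t, z) = 1 / (1 - 2 t z + z ^ 2)` of the Chebyshev polynomials of the
second kind. -/
def chebG (t : ℝ) (z : ℂ) : ℂ :=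
  1 / (1 - 2 * (t : ℂ) * z + z ^ 2)

/-- `h` is bi-univalent, and `h' ≺ G(t, ·)` and `k' ≺ G(t, ·)` where `k = h⁻¹`.  The class
`ℬ_σ^δ(t)` consists of the functions `h_δ` with this property. -/
def MemClassB (t : ℝ) (h : ℂ → ℂ) : Prop :=
  BiUnivalent h ∧ Subordinate (deriv h) (chebG t) ∧
    ∃ k, IsUnivalentInverse h k ∧ Subordinate (deriv k) (chebG t)

/-- The Chebyshev polynomial of the second kind `U_n` at `t`. -/
def chebU (n : ℕ) (t : ℝ) : ℝ :=
  (Polynomial.Chebyshev.U ℝ (n : ℤ)).eval t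

/-- `Ω_{λ,μ,δ}(t)`. -/
def Omega (l m δ t : ℝ) : ℝ :=
  18 * (2 * δ ^ 2 + 1) ^ 2 * (l + m) ^ 3 * chebU 3 t
    - chebU 1 t ^ 3 * (3 * l + m)
      * (3 * (2 * δ ^ 2 + 1) ^ 2 * (m ^ 2 + 3 * m - 4) + 54 * δ * (δ ^ 3 + 2 * δ))

/-- `χ₁(λ, μ, δ; t)`. -/
def chiOne (l m δ t : ℝ) : ℝ :=
  (2 * l + m) ^ 2 * chebU 1 t * |Omega l m δ t|
    + 18 * (l + m) ^ 3
      * (3 * δ * (δ ^ 3 + 2 * δ) * (l + m) * (3 * l + m) - (2 * δ ^ 2 + 1) ^ 2 * (2 * l + m) ^ 2)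
      * chebU 1 t ^ 2
    - 9 * (l + m) ^ 2 * (2 * l + m) * chebU 1 t
      * ((3 * l + m) * (8 * δ ^ 4 - 4 * δ ^ 2 + 5) * chebU 1 t ^ 2
        + 4 * (2 * δ ^ 2 + 1) ^ 2 * (2 * l + m) * (l + m) * chebU 2 t)

/-- `φ(2⁻, t)` for `λ = μ = 1`. -/
def phiTwo (δ t : ℝ) : ℝ :=
  3 * t ^ 2 * ((2 * δ ^ 2 + 1) ^ 2 - t ^ 2 * (5 * δ ^ 4 + 2 * δ ^ 2 + 2))
    / ((δ ^ 2 + 2) * (2 * δ ^ 3 + δ) ^ 2)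

/-- `φ(c₀, t)` for `λ = μ = 1`. -/
def phiCrit (δ t : ℝ) : ℝ :=
  4 * t ^ 2 / (2 * δ ^ 2 + 1) ^ 2
    - t * (3 * (2 * δ ^ 2 + 1) ^ 2 + t * (4 * δ ^ 4 + 20 * δ ^ 2 - 3)
          - t ^ 2 * (64 * δ ^ 4 + 40 * δ ^ 2 + 22)) ^ 2
      / (8 * δ * (2 * δ ^ 2 + 1) ^ 2 * (δ ^ 3 + 2 * δ)
        * (3 * (2 * δ ^ 2 + 1) ^ 2 + t * (-4 * δ ^ 4 + 4 * δ ^ 2 - 3)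
          - t ^ 2 * (64 * δ ^ 4 + 40 * δ ^ 2 + 22)
          + 6 * t * |t ^ 2 * (5 * δ ^ 4 + 2 * δ ^ 2 + 2) - (2 * δ ^ 2 + 1) ^ 2|))

end

/-!
Write `h' = G(t, w)` and `k' = G(t, v)` with Schwarz functions `w = ∑ cᵢ zⁱ` and `v = ∑ dᵢ zⁱ`.
Comparing coefficients in `h' (1 - 2 t w + w²) = 1` and in `h' = 1 - 2 t V + V²`, `V = v ∘ h`
(the derivative of `k (h z) = z`), gives `d₁ = -c₁` and expresses the coefficients of `h`, hence
those of `f`, by the `cᵢ` and `dᵢ` (`MemClassB.exists_schwarz`). The coefficients of `f_δ` come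
from the differential equation `(1 - z²) g' = 2 (δ + z) g` of its derivative `g`
(`taylorCoeff_fDelta`).

Schur's algorithm bounds the Schwarz coefficients by `|c₂| ≤ 1 - |c₁|²` and
`|c₃| ≤ 1 - |c₁|² - |c₂|² / (1 + |c₁|)` (`norm_taylorCoeff_schwarz_le`). After the triangle
inequality (`norm_hankel_le`) the worst case for a given `|c₁|` is `|c₂| = |d₂| = 1 - |c₁|²`
(`second_coeff_bound`). What remains is a quadratic polynomial in `p = |c₁|²` on `[0, 1]`
(`majorant`).

The leading coefficient of this quadratic and `χ₁(1, 1, δ; t)` are positive multiples of the same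
function, `critFactor`, which has a single sign change, at `t₀`. Up to `t₀` the quadratic is convex
and its maximum is the end value at `p = 1`, which is `phiTwo`; after `t₀` it is concave and
bounded by its value at the vertex, which is `phiCrit`.
-/

/-! ### Taylor coefficients at the origin -/

lemma taylorCoeff_zero (f : ℂ → ℂ) : taylorCoeff f 0 = f 0 := by
  simp [taylorCoeff]

lemma taylorCoeff_one (f : ℂ → ℂ) : taylorCoeff f 1 = deriv f 0 := by
  simp [taylorCoeff]

lemma taylorCoeff_congr {f g : ℂ → ℂ} (h : f =ᶠ[𝓝 0] g) (n : ℕ) :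
    taylorCoeff f n = taylorCoeff g n := by
  rw [taylorCoeff, taylorCoeff, h.iteratedDeriv_eq]

lemma taylorCoeff_deriv (f : ℂ → ℂ) (n : ℕ) :
    taylorCoeff (deriv f) n = (n + 1) * taylorCoeff f (n + 1) := by
  have : (n.factorial : ℂ) ≠ 0 := by exact_mod_cast n.factorial_ne_zero
  have : (n + 1 : ℂ) ≠ 0 := by exact_mod_cast n.succ_ne_zero
  rw [taylorCoeff, taylorCoeff, iteratedDeriv_succ', Nat.factorial_succ]
  push_cast
  field_simp

lemma taylorCoeff_eq_of_hasFPowerSeriesAt {f : ℂ → ℂ} {c : ℕ → ℂ}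
    (h : HasFPowerSeriesAt f (FormalMultilinearSeries.ofScalars ℂ c) 0) (n : ℕ) :
    taylorCoeff f n = c n := by
  have h' := h.analyticAt.hasFPowerSeriesAt
  have := h'.eq_formalMultilinearSeries h
  exact congrFun (FormalMultilinearSeries.ofScalars_series_injective ℂ ℂ this) n

lemma taylorCoeff_mul {f g : ℂ → ℂ} (hf : AnalyticAt ℂ f 0) (hg : AnalyticAt ℂ g 0) (n : ℕ) :
    taylorCoeff (fun z => f z * g z) n
      = ∑ i ∈ Finset.range (n + 1), taylorCoeff f i * taylorCoeff g (n - i) := by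
  have h := iteratedDeriv_mul (n := n) hf.contDiffAt hg.contDiffAt
  have h2 : (fun z => f z * g z) = f * g := rfl
  rw [taylorCoeff, h2, h, Finset.sum_div]
  refine Finset.sum_congr rfl fun i hi => ?_
  have hin : i ≤ n := Nat.lt_succ_iff.mp (Finset.mem_range.mp hi)
  have h0 : (n.factorial : ℂ) = n.choose i * i.factorial * (n - i).factorial := by
    exact_mod_cast (Nat.choose_mul_factorial_mul_factorial hin).symm
  have h1 : (n.choose i : ℂ) ≠ 0 := by exact_mod_cast (Nat.choose_pos hin).ne'
  have h3 : (i.factorial : ℂ) ≠ 0 := by exact_mod_cast i.factorial_ne_zero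
  have h4 : ((n - i).factorial : ℂ) ≠ 0 := by exact_mod_cast (n - i).factorial_ne_zero
  rw [taylorCoeff, taylorCoeff, h0]
  field_simp

lemma taylorCoeff_add {f g : ℂ → ℂ} (hf : AnalyticAt ℂ f 0) (hg : AnalyticAt ℂ g 0) (n : ℕ) :
    taylorCoeff (fun z => f z + g z) n = taylorCoeff f n + taylorCoeff g n := by
  have h2 : (fun z => f z + g z) = f + g := rfl
  rw [taylorCoeff, h2, iteratedDeriv_add hf.contDiffAt hg.contDiffAt, add_div]; rfl

lemma taylorCoeff_sub {f g : ℂ → ℂ} (hf : AnalyticAt ℂ f 0) (hg : AnalyticAt ℂ g 0) (n : ℕ) :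
    taylorCoeff (fun z => f z - g z) n = taylorCoeff f n - taylorCoeff g n := by
  have h2 : (fun z => f z - g z) = f - g := rfl
  rw [taylorCoeff, h2, iteratedDeriv_sub hf.contDiffAt hg.contDiffAt, sub_div]; rfl

lemma taylorCoeff_const (c : ℂ) (n : ℕ) :
    taylorCoeff (fun _ => c) n = if n = 0 then c else 0 := by
  rw [taylorCoeff, iteratedDeriv_const]
  split_ifs with h <;> simp [h]

lemma taylorCoeff_id (n : ℕ) : taylorCoeff (fun z => z) n = if n = 1 then 1 else 0 := by
  match n with
  | 0 => simp [taylorCoeff_zero]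
  | 1 => simp [taylorCoeff_one]
  | n + 2 =>
    have : deriv (fun z : ℂ => z) = fun _ => 1 := by ext; simp
    simp [taylorCoeff, iteratedDeriv_succ' , this, iteratedDeriv_const]

lemma taylorCoeff_const_mul {f : ℂ → ℂ} (hf : AnalyticAt ℂ f 0) (c : ℂ) (n : ℕ) :
    taylorCoeff (fun z => c * f z) n = c * taylorCoeff f n := by
  rw [taylorCoeff_mul analyticAt_const hf, Finset.sum_eq_single 0]
  · simp [taylorCoeff_const]
  · intro i _ hi; simp [taylorCoeff_const, hi]
  · simp

lemma taylorCoeff_id_mul {f : ℂ → ℂ} (hf : AnalyticAt ℂ f 0) (n : ℕ) :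
    taylorCoeff (fun z => z * f z) (n + 1) = taylorCoeff f n := by
  rw [taylorCoeff_mul (f := fun z => z) analyticAt_id hf, Finset.sum_eq_single 1]
  · simp [taylorCoeff_id]
  · intro i _ hi; simp [taylorCoeff_id, hi]
  · intro h; simp at h

/-- Passing to the difference quotient at the origin shifts the Taylor coefficients. -/
lemma taylorCoeff_dslope {f : ℂ → ℂ} (hf : DifferentiableOn ℂ f (ball 0 1)) (n : ℕ) :
    taylorCoeff (dslope f 0) n = taylorCoeff f (n + 1) := by
  have hU : ball (0 : ℂ) 1 ∈ 𝓝 (0 : ℂ) := ball_mem_nhds 0 one_pos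
  have hd : DifferentiableOn ℂ (dslope f 0) (ball 0 1) :=
    (Complex.differentiableOn_dslope hU).2 hf
  have h : taylorCoeff (fun z => z * dslope f 0 z) (n + 1)
      = taylorCoeff (fun z => f z - f 0) (n + 1) := by
    refine taylorCoeff_congr (Eventually.of_forall fun z => ?_) _
    simpa using sub_smul_dslope f 0 z
  rw [taylorCoeff_id_mul (hd.analyticAt hU),
    taylorCoeff_sub (hf.analyticAt hU) analyticAt_const, taylorCoeff_const] at h
  simpa using h

/-! ### The coefficients of `f_δ` and of Hadamard products -/

/-- The integrand of `fDelta`, which is also its derivative. -/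
noncomputable def fDeltaIntegrand (δ : ℝ) (u : ℂ) : ℂ :=
  ((1 + u) / (1 - u)) ^ (δ : ℂ) * (1 / (1 - u ^ 2))

lemma one_sub_ne_zero_of_mem_ball {u : ℂ} (hu : u ∈ ball (0 : ℂ) 1) : 1 - u ≠ 0 := by
  rintro h
  have : u = 1 := by linear_combination -h
  simp [this] at hu

lemma one_add_ne_zero_of_mem_ball {u : ℂ} (hu : u ∈ ball (0 : ℂ) 1) : 1 + u ≠ 0 := by
  rintro h
  have : u = -1 := by linear_combination h
  simp [this] at hu

/-- The principal branch of the power is analytic at every value of `(1 + u) / (1 - u)`, as these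
have positive real part. -/
lemma cayley_mem_slitPlane {u : ℂ} (hu : u ∈ ball (0 : ℂ) 1) :
    (1 + u) / (1 - u) ∈ Complex.slitPlane := by
  left
  have h1 := one_sub_ne_zero_of_mem_ball hu
  have hu' : ‖u‖ < 1 := by simpa using hu
  have h2 : Complex.normSq u < 1 := by
    rw [Complex.normSq_eq_norm_sq]; nlinarith [norm_nonneg u]
  have h3 : 0 < Complex.normSq (1 - u) := Complex.normSq_pos.2 h1
  rw [Complex.div_re, ← add_div]
  refine div_pos ?_ h3
  rw [Complex.normSq_apply] at h2
  simp
  nlinarith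

lemma hasDerivAt_fDeltaIntegrand (δ : ℝ) {u : ℂ} (hu : u ∈ ball (0 : ℂ) 1) :
    HasDerivAt (fDeltaIntegrand δ)
      (2 * (δ + u) * fDeltaIntegrand δ u / (1 - u ^ 2)) u := by
  have h1 := one_sub_ne_zero_of_mem_ball hu
  have h2 := one_add_ne_zero_of_mem_ball hu
  have h3 : 1 - u ^ 2 ≠ 0 := by
    have : 1 - u ^ 2 = (1 - u) * (1 + u) := by ring
    rw [this]; exact mul_ne_zero h1 h2
  have hs := cayley_mem_slitPlane hu
  have hne : (1 + u) / (1 - u) ≠ 0 := div_ne_zero h2 h1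
  have hq : HasDerivAt (fun u : ℂ => (1 + u) / (1 - u))
      ((1 * (1 - u) - (1 + u) * (-1)) / (1 - u) ^ 2) u :=
    ((hasDerivAt_id u).const_add 1).div ((hasDerivAt_id u).const_sub 1) h1
  have hp := hq.cpow_const (c := (δ : ℂ)) hs
  have hi : HasDerivAt (fun u : ℂ => 1 / (1 - u ^ 2)) (2 * u / (1 - u ^ 2) ^ 2) u := by
    simp only [one_div]
    refine HasDerivAt.congr_deriv
      (f := fun u : ℂ => (1 - u ^ 2)⁻¹) ((((hasDerivAt_id u).pow 2).const_sub 1).fun_inv h3) ?_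
    simp
  refine (hp.mul hi).congr_deriv ?_
  rw [Complex.cpow_sub _ _ hne, Complex.cpow_one, fDeltaIntegrand]
  have h4 : 1 - u ^ 2 = (1 - u) * (1 + u) := by ring
  rw [h4]
  field_simp
  ring

lemma differentiableOn_fDeltaIntegrand (δ : ℝ) :
    DifferentiableOn ℂ (fDeltaIntegrand δ) (ball 0 1) :=
  fun _ hu => (hasDerivAt_fDeltaIntegrand δ hu).differentiableAt.differentiableWithinAt

lemma hasDerivAt_fDelta (δ : ℝ) {z : ℂ} (hz : z ∈ ball (0 : ℂ) 1) :
    HasDerivAt (fDelta δ) (fDeltaIntegrand δ z) z := by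
  obtain ⟨F, hF0, hF⟩ :=
    (differentiableOn_fDeltaIntegrand δ).isExactOn_ball.with_val_at 0 0
  have key : ∀ z ∈ ball (0 : ℂ) 1, fDelta δ z = F z := by
    intro z hz
    have hmem : ∀ s ∈ uIcc (0 : ℝ) 1, (s : ℂ) * z ∈ ball (0 : ℂ) 1 := by
      intro s hs
      rw [uIcc_of_le zero_le_one] at hs
      simp only [mem_ball, dist_zero_right, norm_mul, Complex.norm_real, Real.norm_eq_abs,
        abs_of_nonneg hs.1] at hz ⊢
      nlinarith [hs.2, norm_nonneg z]
    have hd : ∀ s ∈ uIcc (0 : ℝ) 1, HasDerivAt (fun s : ℝ => F ((s : ℂ) * z))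
        (fDeltaIntegrand δ ((s : ℂ) * z) * z) s := by
      intro s hs
      have h1 : HasDerivAt (fun s : ℂ => s * z) z (s : ℂ) := by
        simpa using (hasDerivAt_id (s : ℂ)).mul_const z
      exact ((hF _ (hmem s hs)).comp (s : ℂ) h1).comp_ofReal
    have hc : ContinuousOn (fun s : ℝ => fDeltaIntegrand δ ((s : ℂ) * z) * z) (uIcc 0 1) := by
      refine ContinuousOn.mul ?_ continuousOn_const
      exact (differentiableOn_fDeltaIntegrand δ).continuousOn.comp
        (by fun_prop) hmem
    have := intervalIntegral.integral_eq_sub_of_hasDerivAt hd hc.intervalIntegrable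
    simpa [hF0, fDelta, fDeltaIntegrand] using this
  exact (hF z hz).congr_of_eventuallyEq
    (Filter.eventuallyEq_of_mem (isOpen_ball.mem_nhds hz) key)

lemma differentiableOn_fDelta (δ : ℝ) : DifferentiableOn ℂ (fDelta δ) (ball 0 1) :=
  fun _ hz => (hasDerivAt_fDelta δ hz).differentiableAt.differentiableWithinAt

lemma taylorCoeff_fDelta (δ : ℝ) :
    taylorCoeff (fDelta δ) 1 = 1 ∧ taylorCoeff (fDelta δ) 2 = δ ∧
    taylorCoeff (fDelta δ) 3 = (2 * δ ^ 2 + 1) / 3 ∧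
    taylorCoeff (fDelta δ) 4 = (δ ^ 3 + 2 * δ) / 3 := by
  have hU : ball (0 : ℂ) 1 ∈ 𝓝 (0 : ℂ) := ball_mem_nhds 0 one_pos
  have hg := (differentiableOn_fDeltaIntegrand δ).analyticAt hU
  have hshift : ∀ n : ℕ, taylorCoeff (fDeltaIntegrand δ) n
      = (n + 1) * taylorCoeff (fDelta δ) (n + 1) := by
    intro n
    rw [← taylorCoeff_deriv]
    exact taylorCoeff_congr (Filter.eventuallyEq_of_mem hU
      fun z hz => ((hasDerivAt_fDelta δ hz).deriv).symm) n
  -- `g = f_δ'` solves `g' = 2 (δ + z) g + z ^ 2 g'`, which is a recursion for its coefficients.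
  have hode : ∀ n, taylorCoeff (deriv (fDeltaIntegrand δ)) n
      = taylorCoeff (fun z => 2 * (δ * fDeltaIntegrand δ z + z * fDeltaIntegrand δ z)
        + z * (z * deriv (fDeltaIntegrand δ) z)) n := by
    refine fun n => taylorCoeff_congr (Filter.eventuallyEq_of_mem hU fun z hz => ?_) n
    have h3 : 1 - z ^ 2 ≠ 0 := by
      have : 1 - z ^ 2 = (1 - z) * (1 + z) := by ring
      rw [this]
      exact mul_ne_zero (one_sub_ne_zero_of_mem_ball hz) (one_add_ne_zero_of_mem_ball hz)
    simp only [(hasDerivAt_fDeltaIntegrand δ hz).deriv]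
    field_simp
    ring
  have hg' := hg.deriv
  have ha : AnalyticAt ℂ (fun z => (δ : ℂ) * fDeltaIntegrand δ z) 0 := by fun_prop
  have hb : AnalyticAt ℂ (fun z => z * fDeltaIntegrand δ z) 0 := by fun_prop
  have hab : AnalyticAt ℂ (fun z => (δ : ℂ) * fDeltaIntegrand δ z + z * fDeltaIntegrand δ z) 0 := by
    fun_prop
  have h2ab : AnalyticAt ℂ
      (fun z => 2 * ((δ : ℂ) * fDeltaIntegrand δ z + z * fDeltaIntegrand δ z)) 0 := by
    fun_prop
  have hc : AnalyticAt ℂ (fun z => z * deriv (fDeltaIntegrand δ) z) 0 := by fun_prop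
  have hcc : AnalyticAt ℂ (fun z => z * (z * deriv (fDeltaIntegrand δ) z)) 0 := by fun_prop
  have e0 := hode 0
  have e1 := hode 1
  have e2 := hode 2
  simp only [taylorCoeff_add h2ab hcc, taylorCoeff_const_mul hab, taylorCoeff_add ha hb,
    taylorCoeff_const_mul hg] at e0 e1 e2
  rw [taylorCoeff_id_mul hg, taylorCoeff_id_mul hc] at e1 e2
  rw [taylorCoeff_id_mul hg'] at e2
  simp only [taylorCoeff_deriv, taylorCoeff_zero (fun z => z * _), zero_mul] at e0 e1 e2
  have g0 : taylorCoeff (fDeltaIntegrand δ) 0 = 1 := by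
    simp [taylorCoeff_zero, fDeltaIntegrand]
  rw [hshift] at g0
  simp only [hshift] at e0 e1 e2
  norm_num at e0 e1 e2 g0
  rw [g0] at e0 e1
  have b2 : taylorCoeff (fDelta δ) 2 = δ := by linear_combination e0
  rw [b2] at e1 e2
  have b3 : taylorCoeff (fDelta δ) 3 = (2 * δ ^ 2 + 1) / 3 := by linear_combination e1 / 3
  rw [b3] at e2
  exact ⟨g0, b2, b3, by linear_combination e2 / 12⟩

lemma exists_norm_taylorCoeff_le {f : ℂ → ℂ} (hf : DifferentiableOn ℂ f (ball 0 1)) :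
    ∃ C, ∀ n, ‖taylorCoeff f n‖ ≤ C * 2 ^ n := by
  have hz : (1 / 2 : ℂ) ∈ ball (0 : ℂ) 1 := by simp; norm_num
  have hs := (Complex.hasSum_taylorSeries_on_ball hf hz).summable
  obtain ⟨C, hC⟩ := hs.tendsto_atTop_zero.norm.bddAbove_range
  refine ⟨C, fun n => ?_⟩
  have h := hC ⟨n, rfl⟩
  have h2 : ‖((1 / 2 : ℂ) - 0) ^ n‖ = (2 ^ n)⁻¹ := by simp
  have h3 : taylorCoeff f n
      = 2 ^ n * ((n.factorial : ℂ)⁻¹ • ((1 / 2 : ℂ) - 0) ^ n • iteratedDeriv n f 0) := by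
    simp only [taylorCoeff, sub_zero, smul_eq_mul, div_pow, one_pow]
    field_simp
  rw [h3, norm_mul]
  simp only [norm_pow, Complex.norm_ofNat]
  rw [mul_comm]
  exact mul_le_mul_of_nonneg_right h (by positivity)

/-- Taylor coefficients of a Hadamard product; the product series converges near the origin, which
is all that is needed. -/
lemma taylorCoeff_hadamardProd {f g : ℂ → ℂ} (hf : DifferentiableOn ℂ f (ball 0 1))
    (hg : DifferentiableOn ℂ g (ball 0 1)) (n : ℕ) :
    taylorCoeff (hadamardProd f g) n = taylorCoeff f n * taylorCoeff g n := by
  obtain ⟨C, hC⟩ := exists_norm_taylorCoeff_le hf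
  obtain ⟨D, hD⟩ := exists_norm_taylorCoeff_le hg
  set c : ℕ → ℂ := fun n => taylorCoeff f n * taylorCoeff g n with hc
  have hr : (0 : ENNReal) < (FormalMultilinearSeries.ofScalars ℂ c).radius := by
    have : ((1 / 4 : NNReal) : ENNReal) ≤ (FormalMultilinearSeries.ofScalars ℂ c).radius := by
      refine FormalMultilinearSeries.le_radius_of_bound _ (C * D) fun k => ?_
      rw [FormalMultilinearSeries.ofScalars_norm, hc, norm_mul]
      have h1 := mul_le_mul (hC k) (hD k) (norm_nonneg _) ((norm_nonneg _).trans (hC k))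
      have h4 : (2 : ℝ) ^ k * 2 ^ k * (1 / 4) ^ k = 1 := by
        rw [← mul_pow, ← mul_pow]; norm_num
      calc _ ≤ C * 2 ^ k * (D * 2 ^ k) * (1 / 4) ^ k := by
            push_cast; gcongr
        _ = C * D * (2 ^ k * 2 ^ k * (1 / 4) ^ k) := by ring
        _ = C * D := by rw [h4, mul_one]
    refine lt_of_lt_of_le ?_ this
    simp
  have h := (FormalMultilinearSeries.hasFPowerSeriesOnBall _ hr).hasFPowerSeriesAt
  have h2 : (FormalMultilinearSeries.ofScalars ℂ c).sum = hadamardProd f g := by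
    ext z
    have := FormalMultilinearSeries.ofScalars_sum_eq (E := ℂ) c z
    rw [hadamardProd]
    simpa only [FormalMultilinearSeries.ofScalarsSum, smul_eq_mul] using this
  rw [h2] at h
  exact taylorCoeff_eq_of_hasFPowerSeriesAt h n

/-! ### Coefficients of bounded analytic functions -/

/-- The Schur step: a disc self-map `φ` with `‖φ 0‖ < 1` is obtained from the self-map `χ` by
`(φ - φ 0) / (1 - conj (φ 0) * φ) = z * χ`; the first coefficients of the two are related as
stated. -/
lemma exists_schur_step {φ : ℂ → ℂ} (hd : DifferentiableOn ℂ φ (ball 0 1))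
    (hb : ∀ z ∈ ball (0 : ℂ) 1, ‖φ z‖ ≤ 1) (h0 : ‖φ 0‖ < 1) :
    ∃ χ : ℂ → ℂ, DifferentiableOn ℂ χ (ball 0 1) ∧ (∀ z ∈ ball (0 : ℂ) 1, ‖χ z‖ ≤ 1) ∧
      taylorCoeff φ 1 = (1 - ‖φ 0‖ ^ 2) * taylorCoeff χ 0 ∧
      taylorCoeff φ 2 = (1 - ‖φ 0‖ ^ 2) * taylorCoeff χ 1
        - star (φ 0) * taylorCoeff χ 0 * taylorCoeff φ 1 := by
  have hU : ball (0 : ℂ) 1 ∈ 𝓝 (0 : ℂ) := ball_mem_nhds 0 one_pos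
  have hsq : φ 0 * star (φ 0) = ‖φ 0‖ ^ 2 := by
    simpa using Complex.mul_conj' (φ 0)
  have hlt : ∀ z ∈ ball (0 : ℂ) 1, ‖star (φ 0) * φ z‖ < 1 := by
    intro z hz
    rw [norm_mul, norm_star]
    nlinarith [hb z hz, norm_nonneg (φ z), norm_nonneg (φ 0)]
  have hden : ∀ z ∈ ball (0 : ℂ) 1, 1 - star (φ 0) * φ z ≠ 0 := by
    intro z hz h
    have h1 : star (φ 0) * φ z = 1 := by linear_combination -h
    exact absurd (hlt z hz) (by rw [h1]; simp)
  set ψ : ℂ → ℂ := fun z => (φ z - φ 0) / (1 - star (φ 0) * φ z) with hψ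
  have hψd : DifferentiableOn ℂ ψ (ball 0 1) :=
    (hd.sub_const _).div ((hd.const_mul _).const_sub _) hden
  have hψ0 : ψ 0 = 0 := by simp [hψ]
  have hψb : MapsTo ψ (ball 0 1) (closedBall (ψ 0) 1) := by
    intro z hz
    rw [hψ0, mem_closedBall_zero_iff, hψ, norm_div,
      div_le_one (norm_pos_iff.2 (hden z hz))]
    -- `|1 - conj a * b|² - |b - a|² = (1 - |a|²) (1 - |b|²)`
    have key : ‖1 - star (φ 0) * φ z‖ ^ 2 - ‖φ z - φ 0‖ ^ 2
        = (1 - ‖φ 0‖ ^ 2) * (1 - ‖φ z‖ ^ 2) := by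
      simp only [← Complex.normSq_eq_norm_sq, Complex.normSq_apply]
      simp
      ring
    have h1 : 0 ≤ 1 - ‖φ 0‖ ^ 2 := by nlinarith [norm_nonneg (φ 0)]
    have h2 : 0 ≤ 1 - ‖φ z‖ ^ 2 := by nlinarith [norm_nonneg (φ z), hb z hz]
    exact pow_le_pow_iff_left₀ (norm_nonneg _) (norm_nonneg _) two_ne_zero |>.1
      (by nlinarith [mul_nonneg h1 h2])
  refine ⟨dslope ψ 0, (Complex.differentiableOn_dslope hU).2 hψd, fun z hz => ?_, ?_⟩
  · simpa using Complex.norm_dslope_le_div_of_mapsTo_ball hψd hψb hz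
  have hφa := hd.analyticAt hU
  have hψa := hψd.analyticAt hU
  have hprod : ∀ n, taylorCoeff (fun z => ψ z * (1 - star (φ 0) * φ z)) n
      = taylorCoeff (fun z => φ z - φ 0) n := by
    refine fun n => taylorCoeff_congr (Filter.eventuallyEq_of_mem hU fun z hz => ?_) n
    exact div_mul_cancel₀ _ (hden z hz)
  have hma : AnalyticAt ℂ (fun z => star (φ 0) * φ z) 0 := by fun_prop
  have hma' : AnalyticAt ℂ (fun z => 1 - star (φ 0) * φ z) 0 := by fun_prop
  have e1 := hprod 1
  have e2 := hprod 2
  simp only [taylorCoeff_mul hψa hma', taylorCoeff_sub hφa analyticAt_const,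
    taylorCoeff_sub analyticAt_const hma, taylorCoeff_const_mul hφa, taylorCoeff_const,
    Finset.sum_range_succ, Finset.sum_range_zero, taylorCoeff_zero, hψ0] at e1 e2
  rw [taylorCoeff_dslope hψd, taylorCoeff_dslope hψd]
  norm_num at e1 e2
  have hsq' : (starRingEnd ℂ) (φ 0) * φ 0 = ‖φ 0‖ ^ 2 := by rw [mul_comm]; exact hsq
  rw [taylorCoeff_zero φ, hsq'] at e1 e2
  constructor
  · rw [← e1]; ring
  · rw [← e2]
    simp only [RCLike.star_def]
    ring

/-- A disc self-map that attains modulus one is constant. -/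
lemma taylorCoeff_eq_zero_of_norm_eq_one {φ : ℂ → ℂ} (hd : DifferentiableOn ℂ φ (ball 0 1))
    (hb : ∀ z ∈ ball (0 : ℂ) 1, ‖φ z‖ ≤ 1) (h0 : ‖φ 0‖ = 1) {n : ℕ} (hn : n ≠ 0) :
    taylorCoeff φ n = 0 := by
  have h := Complex.eqOn_of_isPreconnected_of_isMaxOn_norm
    (convex_ball (0 : ℂ) 1).isPreconnected isOpen_ball hd (mem_ball_self one_pos)
    (fun z hz => by simpa [h0] using hb z hz)
  rw [taylorCoeff_congr (Filter.eventuallyEq_of_mem (ball_mem_nhds 0 one_pos) h)]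
  exact (taylorCoeff_const (φ 0) n).trans (if_neg hn)

lemma norm_taylorCoeff_one_le {φ : ℂ → ℂ} (hd : DifferentiableOn ℂ φ (ball 0 1))
    (hb : ∀ z ∈ ball (0 : ℂ) 1, ‖φ z‖ ≤ 1) : ‖taylorCoeff φ 1‖ ≤ 1 - ‖φ 0‖ ^ 2 := by
  have h00 : (0 : ℂ) ∈ ball (0 : ℂ) 1 := mem_ball_self one_pos
  rcases (hb 0 h00).lt_or_eq with h0 | h0
  · obtain ⟨χ, -, hχ, h1, -⟩ := exists_schur_step hd hb h0
    have h2 : 0 ≤ 1 - ‖φ 0‖ ^ 2 := by nlinarith [norm_nonneg (φ 0)]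
    have h3 : ‖(1 - (‖φ 0‖ : ℂ) ^ 2)‖ = 1 - ‖φ 0‖ ^ 2 := by
      exact_mod_cast Complex.norm_of_nonneg h2
    rw [h1, norm_mul, h3, taylorCoeff_zero]
    exact mul_le_of_le_one_right h2 (hχ 0 h00)
  · rw [taylorCoeff_eq_zero_of_norm_eq_one hd hb h0 one_ne_zero, h0]
    simp

/-- The second coefficient of a disc self-map; this is the Schwarz–Pick bound for the Schur
transform. -/
lemma norm_taylorCoeff_two_le {φ : ℂ → ℂ} (hd : DifferentiableOn ℂ φ (ball 0 1))
    (hb : ∀ z ∈ ball (0 : ℂ) 1, ‖φ z‖ ≤ 1) :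
    ‖taylorCoeff φ 2‖ ≤ 1 - ‖φ 0‖ ^ 2 - ‖taylorCoeff φ 1‖ ^ 2 / (1 + ‖φ 0‖) := by
  have h00 : (0 : ℂ) ∈ ball (0 : ℂ) 1 := mem_ball_self one_pos
  rcases (hb 0 h00).lt_or_eq with h0 | h0
  · obtain ⟨χ, hχd, hχ, h1, h2⟩ := exists_schur_step hd hb h0
    have hp : 0 < 1 - ‖φ 0‖ ^ 2 := by nlinarith [norm_nonneg (φ 0)]
    have h3 : ‖(1 - (‖φ 0‖ : ℂ) ^ 2)‖ = 1 - ‖φ 0‖ ^ 2 := by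
      exact_mod_cast Complex.norm_of_nonneg hp.le
    have h4 := norm_taylorCoeff_one_le hχd hχ
    have h5 : ‖taylorCoeff φ 1‖ = (1 - ‖φ 0‖ ^ 2) * ‖χ 0‖ := by
      rw [h1, norm_mul, h3, taylorCoeff_zero]
    have h6 : ‖taylorCoeff φ 2‖ ≤ (1 - ‖φ 0‖ ^ 2) * ‖taylorCoeff χ 1‖
        + ‖φ 0‖ * ‖χ 0‖ * ((1 - ‖φ 0‖ ^ 2) * ‖χ 0‖) := by
      rw [← h5, ← h3, h2]
      refine (norm_sub_le _ _).trans_eq ?_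
      simp only [norm_mul, norm_star, taylorCoeff_zero]
    have h7 : ((1 - ‖φ 0‖ ^ 2) * ‖χ 0‖) ^ 2 / (1 + ‖φ 0‖)
        = (1 - ‖φ 0‖ ^ 2) * (1 - ‖φ 0‖) * ‖χ 0‖ ^ 2 := by
      have : 1 + ‖φ 0‖ ≠ 0 := by positivity
      field_simp
      ring
    rw [h5, h7]
    nlinarith [mul_le_mul_of_nonneg_left h4 hp.le]
  · rw [taylorCoeff_eq_zero_of_norm_eq_one hd hb h0 two_ne_zero,
      taylorCoeff_eq_zero_of_norm_eq_one hd hb h0 one_ne_zero, h0]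
    simp

/-- The bounds on the first three coefficients of a Schwarz function. -/
lemma norm_taylorCoeff_schwarz_le {w : ℂ → ℂ} (hd : DifferentiableOn ℂ w (ball 0 1))
    (h0 : w 0 = 0) (hb : ∀ z ∈ ball (0 : ℂ) 1, ‖w z‖ < 1) :
    ‖taylorCoeff w 1‖ ≤ 1 ∧ ‖taylorCoeff w 2‖ ≤ 1 - ‖taylorCoeff w 1‖ ^ 2 ∧
    ‖taylorCoeff w 3‖ ≤ 1 - ‖taylorCoeff w 1‖ ^ 2
      - ‖taylorCoeff w 2‖ ^ 2 / (1 + ‖taylorCoeff w 1‖) := by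
  have hφd := (Complex.differentiableOn_dslope (f := w) (ball_mem_nhds (0 : ℂ) one_pos)).2 hd
  have hφb : ∀ z ∈ ball (0 : ℂ) 1, ‖dslope w 0 z‖ ≤ 1 := by
    intro z hz
    have hm : MapsTo w (ball 0 1) (closedBall (w 0) 1) := fun z hz => by
      simpa [h0] using (hb z hz).le
    simpa using Complex.norm_dslope_le_div_of_mapsTo_ball hd hm hz
  have h1 := norm_taylorCoeff_one_le hφd hφb
  have h2 := norm_taylorCoeff_two_le hφd hφb
  have h3 := hφb 0 (mem_ball_self one_pos)
  rw [← taylorCoeff_zero (dslope w 0)] at h1 h2 h3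
  simp only [taylorCoeff_dslope hd, zero_add] at h1 h2 h3
  exact ⟨h3, h1, h2⟩

/-! ### Coefficient relations for the bi-univalent class -/

/-- The recursion behind the coefficients of a composition:
`v ∘ h = v 0 + h * (dslope v 0 ∘ h)`. -/
lemma taylorCoeff_comp_succ {v h : ℂ → ℂ} (hv : DifferentiableOn ℂ v (ball 0 1))
    (hh : AnalyticAt ℂ h 0) (h0 : h 0 = 0) (n : ℕ) :
    taylorCoeff (fun z => v (h z)) (n + 1) = ∑ i ∈ Finset.range (n + 2),
      taylorCoeff h i * taylorCoeff (fun z => dslope v 0 (h z)) (n + 1 - i) := by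
  have hU : ball (0 : ℂ) 1 ∈ 𝓝 (0 : ℂ) := ball_mem_nhds 0 one_pos
  have hd : DifferentiableOn ℂ (dslope v 0) (ball 0 1) :=
    (Complex.differentiableOn_dslope hU).2 hv
  have hda : AnalyticAt ℂ (dslope v 0) (h 0) := by rw [h0]; exact hd.analyticAt hU
  have hc : AnalyticAt ℂ (fun z => dslope v 0 (h z)) 0 := hda.comp hh
  rw [← taylorCoeff_mul hh hc]
  have h1 : taylorCoeff (fun z => v (h z)) (n + 1)
      = taylorCoeff (fun z => v 0 + h z * dslope v 0 (h z)) (n + 1) := by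
    refine taylorCoeff_congr (Eventually.of_forall fun z => ?_) _
    have := sub_smul_dslope v 0 (h z)
    simp only [sub_zero, smul_eq_mul] at this
    simp [this]
  have hm : AnalyticAt ℂ (fun z => h z * dslope v 0 (h z)) 0 := hh.mul hc
  rw [h1, taylorCoeff_add analyticAt_const hm, taylorCoeff_const]
  simp

lemma taylorCoeff_comp_normalized {v h : ℂ → ℂ} (hv : DifferentiableOn ℂ v (ball 0 1))
    (hh : AnalyticAt ℂ h 0) (h0 : h 0 = 0) (h1 : taylorCoeff h 1 = 1) :
    taylorCoeff (fun z => v (h z)) 1 = taylorCoeff v 1 ∧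
    taylorCoeff (fun z => v (h z)) 2 = taylorCoeff v 1 * taylorCoeff h 2 + taylorCoeff v 2 ∧
    taylorCoeff (fun z => v (h z)) 3 = taylorCoeff v 1 * taylorCoeff h 3
      + 2 * taylorCoeff v 2 * taylorCoeff h 2 + taylorCoeff v 3 := by
  have hU : ball (0 : ℂ) 1 ∈ 𝓝 (0 : ℂ) := ball_mem_nhds 0 one_pos
  have h00 : taylorCoeff h 0 = 0 := by rw [taylorCoeff_zero, h0]
  have hd1 := (Complex.differentiableOn_dslope hU).2 hv
  have hd2 := (Complex.differentiableOn_dslope hU).2 hd1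
  have hz : ∀ v : ℂ → ℂ, taylorCoeff (fun z => v (h z)) 0 = taylorCoeff v 0 := by
    intro v; rw [taylorCoeff_zero, taylorCoeff_zero, h0]
  have e1 : ∀ v : ℂ → ℂ, DifferentiableOn ℂ v (ball 0 1) →
      taylorCoeff (fun z => v (h z)) 1 = taylorCoeff v 1 := by
    intro v hv
    rw [taylorCoeff_comp_succ hv hh h0]
    simp only [Finset.sum_range_succ, Finset.sum_range_zero, h00, h1, hz]
    norm_num [hz, taylorCoeff_dslope hv]
  have e2 : ∀ v : ℂ → ℂ, DifferentiableOn ℂ v (ball 0 1) →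
      taylorCoeff (fun z => v (h z)) 2
        = taylorCoeff v 1 * taylorCoeff h 2 + taylorCoeff v 2 := by
    intro v hv
    rw [taylorCoeff_comp_succ hv hh h0]
    simp only [Finset.sum_range_succ, Finset.sum_range_zero, h00, h1]
    norm_num [hz, e1 _ ((Complex.differentiableOn_dslope hU).2 hv), taylorCoeff_dslope hv]
    ring
  refine ⟨e1 v hv, e2 v hv, ?_⟩
  rw [taylorCoeff_comp_succ hv hh h0]
  simp only [Finset.sum_range_succ, Finset.sum_range_zero, h00, h1]
  norm_num [hz, e1 _ hd1, e2 _ hd1, taylorCoeff_dslope hv]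
  ring

/-- The coefficients of a function `p` with `p * (1 - 2 t w + w ^ 2) = 1`, i.e. `p = G(t, w)`. -/
lemma taylorCoeff_of_mul_eq_one {p w : ℂ → ℂ} {t : ℂ} (hp : AnalyticAt ℂ p 0)
    (hw : AnalyticAt ℂ w 0) (w0 : w 0 = 0)
    (h : ∀ᶠ z in 𝓝 0, p z * (1 - 2 * t * w z + w z ^ 2) = 1) :
    taylorCoeff p 1 = 2 * t * taylorCoeff w 1 ∧
    taylorCoeff p 2 = 2 * t * taylorCoeff w 2 + (4 * t ^ 2 - 1) * taylorCoeff w 1 ^ 2 ∧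
    taylorCoeff p 3 = 2 * t * taylorCoeff w 3
      + 2 * (4 * t ^ 2 - 1) * taylorCoeff w 1 * taylorCoeff w 2
      + (8 * t ^ 3 - 4 * t) * taylorCoeff w 1 ^ 3 := by
  have w00 : taylorCoeff w 0 = 0 := by rw [taylorCoeff_zero, w0]
  have ha : AnalyticAt ℂ (fun z => 2 * t * w z) 0 := by fun_prop
  have hb : AnalyticAt ℂ (fun z => 1 - 2 * t * w z) 0 := by fun_prop
  have hc : AnalyticAt ℂ (fun z => w z * w z) 0 := by fun_prop
  have hd : AnalyticAt ℂ (fun z => 1 - 2 * t * w z + w z * w z) 0 := by fun_prop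
  have key : ∀ n, taylorCoeff (fun z => p z * (1 - 2 * t * w z + w z * w z)) n
      = taylorCoeff (fun _ => 1) n := by
    refine fun n => taylorCoeff_congr ?_ n
    filter_upwards [h] with z hz
    rw [← pow_two, hz]
  have e0 := key 0
  have e1 := key 1
  have e2 := key 2
  have e3 := key 3
  simp only [taylorCoeff_mul hp hd, taylorCoeff_add hb hc, taylorCoeff_sub analyticAt_const ha,
    taylorCoeff_const_mul hw, taylorCoeff_mul hw hw, taylorCoeff_const, Finset.sum_range_succ,
    Finset.sum_range_zero, w00] at e0 e1 e2 e3
  norm_num [w00] at e0 e1 e2 e3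
  rw [e0] at e1 e2 e3
  have p1 : taylorCoeff p 1 = 2 * t * taylorCoeff w 1 := by linear_combination e1
  rw [p1] at e2 e3
  have p2 : taylorCoeff p 2 = 2 * t * taylorCoeff w 2 + (4 * t ^ 2 - 1) * taylorCoeff w 1 ^ 2 := by
    linear_combination e2
  rw [p2] at e3
  exact ⟨p1, p2, by linear_combination e3⟩

/-- The relations between the coefficients `A₂, A₃, A₄` of a member of `ℬ` and those of the two
Schwarz functions. Subtracting and adding the equations for `h` and for `h⁻¹` shows that the first
coefficients of `w` and `v` are opposite and gives these symmetric forms. -/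
lemma MemClassB.exists_schwarz {t : ℝ} (ht : t ≠ 0) {h : ℂ → ℂ} (hB : MemClassB t h) :
    ∃ c d : ℕ → ℂ,
      (‖c 1‖ ≤ 1 ∧ ‖c 2‖ ≤ 1 - ‖c 1‖ ^ 2 ∧
        ‖c 3‖ ≤ 1 - ‖c 1‖ ^ 2 - ‖c 2‖ ^ 2 / (1 + ‖c 1‖)) ∧
      (‖d 1‖ ≤ 1 ∧ ‖d 2‖ ≤ 1 - ‖d 1‖ ^ 2 ∧
        ‖d 3‖ ≤ 1 - ‖d 1‖ ^ 2 - ‖d 2‖ ^ 2 / (1 + ‖d 1‖)) ∧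
      d 1 = -c 1 ∧
      taylorCoeff h 2 = t * c 1 ∧
      taylorCoeff h 3 = t ^ 2 * c 1 ^ 2 + t * (c 2 - d 2) / 3 ∧
      taylorCoeff h 4 = t * (c 3 - d 3) / 4 + (4 * t ^ 2 - 1) * c 1 * (c 2 + d 2) / 4
        + (2 * t ^ 3 - t) * c 1 ^ 3 + 5 / 6 * t ^ 2 * c 1 * (c 2 - d 2) := by
  obtain ⟨⟨⟨hd, h0, h1⟩, -, -⟩, ⟨w, hwd, w0, hw⟩, k, ⟨hkd, -, hk⟩, v, hvd, v0, hv⟩ := hB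
  have hU : ball (0 : ℂ) 1 ∈ 𝓝 (0 : ℂ) := ball_mem_nhds 0 one_pos
  have hha := hd.analyticAt hU
  have hwa := hwd.analyticAt hU
  have hva : AnalyticAt ℂ v (h 0) := by rw [h0]; exact hvd.analyticAt hU
  have hVa : AnalyticAt ℂ (fun z => v (h z)) 0 := hva.comp hha
  have E := taylorCoeff_of_mul_eq_one (t := t) hha.deriv hwa w0 <| by
    have hne : ∀ᶠ z in 𝓝 (0 : ℂ), 1 - 2 * (t : ℂ) * w z + w z ^ 2 ≠ 0 := by
      have hca : ContinuousAt (fun z => 1 - 2 * (t : ℂ) * w z + w z ^ 2) 0 := by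
        have := hwa.continuousAt
        fun_prop
      exact hca.eventually_ne (by simp [w0])
    filter_upwards [hne, hU] with z hz hzU
    rw [(hw z hzU).2, chebG, one_div, inv_mul_cancel₀ hz]
  -- Differentiating `k (h z) = z` gives `h' = 1 - 2 t V + V ^ 2` with `V = v ∘ h`.
  have hV : ∀ᶠ z in 𝓝 (0 : ℂ), deriv h z
      = 1 - 2 * (t : ℂ) * v (h z) + v (h z) * v (h z) := by
    have hmem : ∀ᶠ z in 𝓝 (0 : ℂ), h z ∈ ball (0 : ℂ) 1 :=
      hha.continuousAt.eventually (by rw [h0]; exact hU)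
    filter_upwards [hk.eventually_nhds, hmem, hU] with z hz hzm hzU
    have hkz := (hkd.differentiableAt (isOpen_ball.mem_nhds hzm)).hasDerivAt
    have hhz := (hd.differentiableAt (isOpen_ball.mem_nhds hzU)).hasDerivAt
    have h2 : HasDerivAt (fun z => z) (deriv k (h z) * deriv h z) z :=
      (hkz.comp z hhz).congr_of_eventuallyEq (by
        filter_upwards [hz] with y hy
        exact hy.symm)
    have h3 : deriv k (h z) * deriv h z = 1 := h2.unique (hasDerivAt_id z)
    rw [(hv _ hzm).2, chebG, one_div] at h3
    have h4 : 1 - 2 * (t : ℂ) * v (h z) + v (h z) ^ 2 ≠ 0 := by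
      intro h4
      rw [h4] at h3
      simp at h3
    rw [inv_mul_eq_iff_eq_mul₀ h4] at h3
    rw [h3]
    ring
  have hco : ∀ n, taylorCoeff (deriv h) n
      = taylorCoeff (fun z => 1 - 2 * (t : ℂ) * v (h z) + v (h z) * v (h z)) n :=
    fun n => taylorCoeff_congr hV n
  rw [← taylorCoeff_one] at h1
  obtain ⟨V1, V2, V3⟩ := taylorCoeff_comp_normalized hvd hha h0 h1
  have V0 : taylorCoeff (fun z => v (h z)) 0 = 0 := by rw [taylorCoeff_zero, h0, v0]
  have ha : AnalyticAt ℂ (fun z => 2 * (t : ℂ) * v (h z)) 0 := by fun_prop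
  have hb : AnalyticAt ℂ (fun z => 1 - 2 * (t : ℂ) * v (h z)) 0 := by fun_prop
  have hc : AnalyticAt ℂ (fun z => v (h z) * v (h z)) 0 := by fun_prop
  have f1 := hco 1
  have f2 := hco 2
  have f3 := hco 3
  simp only [taylorCoeff_add hb hc, taylorCoeff_sub analyticAt_const ha,
    taylorCoeff_const_mul hVa, taylorCoeff_mul hVa hVa, taylorCoeff_const, Finset.sum_range_succ,
    Finset.sum_range_zero, V0, V1, V2, V3, taylorCoeff_deriv] at f1 f2 f3
  simp only [taylorCoeff_deriv] at E
  norm_num [V0, V1, V2, V3] at f1 f2 f3 E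
  obtain ⟨e1, e2, e3⟩ := E
  refine ⟨taylorCoeff w, taylorCoeff v,
    norm_taylorCoeff_schwarz_le hwd w0 fun z hz => (hw z hz).1,
    norm_taylorCoeff_schwarz_le hvd v0 fun z hz => (hv z hz).1, ?_⟩
  generalize taylorCoeff w 1 = c1 at *
  generalize taylorCoeff w 2 = c2 at *
  generalize taylorCoeff w 3 = c3 at *
  generalize taylorCoeff v 1 = d1 at *
  generalize taylorCoeff v 2 = d2 at *
  generalize taylorCoeff v 3 = d3 at *
  have htc : (t : ℂ) ≠ 0 := by exact_mod_cast ht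
  have hd1 : d1 = -c1 := by
    refine mul_left_cancel₀ htc ?_
    linear_combination (f1 - e1) / 2
  subst hd1
  have hA2 : taylorCoeff h 2 = t * c1 := by linear_combination e1 / 2
  rw [hA2] at f2 f3
  have hA3 : taylorCoeff h 3 = t ^ 2 * c1 ^ 2 + t * (c2 - d2) / 3 := by
    linear_combination (e2 + f2) / 6
  rw [hA3] at e2 f2 f3
  refine ⟨rfl, hA2, hA3, ?_⟩
  linear_combination (e3 + f3) / 8 + 3 / 8 * t * c1 * (e2 - f2)

/-! ### The sign of `χ₁` -/

/-- The denominator of `phiCrit`, up to a positive factor; also the factor of `chiOne 1 1` that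
decides its sign. -/
noncomputable def critFactor (δ t : ℝ) : ℝ :=
  3 * (2 * δ ^ 2 + 1) ^ 2 + t * (-4 * δ ^ 4 + 4 * δ ^ 2 - 3)
    - t ^ 2 * (64 * δ ^ 4 + 40 * δ ^ 2 + 22)
    + 6 * t * |t ^ 2 * (5 * δ ^ 4 + 2 * δ ^ 2 + 2) - (2 * δ ^ 2 + 1) ^ 2|

lemma chebU_one (t : ℝ) : chebU 1 t = 2 * t := by
  simp [chebU]

lemma chebU_two (t : ℝ) : chebU 2 t = 4 * t ^ 2 - 1 := by
  simp [chebU, Polynomial.Chebyshev.U_two]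

lemma chebU_three (t : ℝ) : chebU 3 t = 8 * t ^ 3 - 4 * t := by
  have h : Polynomial.Chebyshev.U ℝ 3 = 2 * Polynomial.X * Polynomial.Chebyshev.U ℝ 2
      - Polynomial.Chebyshev.U ℝ 1 := Polynomial.Chebyshev.U_add_two ℝ 1
  simp [chebU, h, Polynomial.Chebyshev.U_two]
  ring

lemma chiOne_one_one (δ : ℝ) {t : ℝ} (ht : 0 < t) :
    chiOne 1 1 δ t = 1728 * t * critFactor δ t := by
  have h : Omega 1 1 δ t
      = 576 * t * (t ^ 2 * (5 * δ ^ 4 + 2 * δ ^ 2 + 2) - (2 * δ ^ 2 + 1) ^ 2) := by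
    rw [Omega, chebU_one, chebU_three]
    ring
  rw [chiOne, h, chebU_one, chebU_two, critFactor, abs_mul,
    abs_of_pos (by positivity : 0 < 576 * t)]
  ring

lemma critFactor_half_pos {δ : ℝ} (hδ : 1 ≤ δ) : 0 < critFactor δ (1 / 2) := by
  have h1 : 1 ≤ δ ^ 2 := one_le_pow₀ hδ
  have h := neg_le_abs ((1 / 2 : ℝ) ^ 2 * (5 * δ ^ 4 + 2 * δ ^ 2 + 2) - (2 * δ ^ 2 + 1) ^ 2)
  rw [critFactor]
  nlinarith

/-- The hypothesis says that the value of `majorant` at `p = 0` is at least its value at `p = 1`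
without the absolute value; from there on the factor is negative. -/
lemma critFactor_neg {δ t : ℝ} (hδ : 1 ≤ δ) (h0 : 0 < t) (h1 : t ≤ 1)
    (h : 9 * (2 * δ ^ 2 + 1) ^ 2 - 12 * δ ^ 2 * (δ ^ 2 + 2)
      ≤ 9 * (t ^ 2 * (5 * δ ^ 4 + 2 * δ ^ 2 + 2))) : critFactor δ t < 0 := by
  have hx : 1 ≤ δ ^ 2 := one_le_pow₀ hδ
  have h4 : δ ^ 4 = (δ ^ 2) ^ 2 := by ring
  rw [critFactor]
  rw [h4] at h ⊢
  generalize δ ^ 2 = x at *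
  rcases le_total 0 (t ^ 2 * (5 * x ^ 2 + 2 * x + 2) - (2 * x + 1) ^ 2) with hs | hs
  · rw [abs_of_nonneg hs]
    have ht2 : 0 < t ^ 2 := by positivity
    have a1 : t * (t ^ 2 * (5 * x ^ 2 + 2 * x + 2) - (2 * x + 1) ^ 2)
        ≤ t ^ 2 * ((5 * x ^ 2 + 2 * x + 2) - (2 * x + 1) ^ 2) := by
      have b1 : 0 ≤ t ^ 2 * (1 - t) * (5 * x ^ 2 + 2 * x + 2) := by
        have : 0 ≤ 1 - t := by linarith
        positivity
      have b2 : 0 ≤ t * (1 - t) * (2 * x + 1) ^ 2 := by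
        have : 0 ≤ 1 - t := by linarith
        positivity
      nlinarith
    have a2 : t * (-4 * x ^ 2 + 4 * x - 3) < 0 := mul_neg_of_pos_of_neg h0 (by nlinarith)
    have a3 : 0 < t ^ 2 * (43 * x ^ 2 + 46 * x + 10) := by positivity
    nlinarith
  · rw [abs_of_nonpos hs]
    have ht2 : 1 / 2 < t ^ 2 := by
      by_contra hc
      have : t ^ 2 * (5 * x ^ 2 + 2 * x + 2) ≤ 1 / 2 * (5 * x ^ 2 + 2 * x + 2) :=
        mul_le_mul_of_nonneg_right (not_lt.1 hc) (by positivity)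
      nlinarith
    have a1 : t * ((2 * x + 1) ^ 2 - t ^ 2 * (5 * x ^ 2 + 2 * x + 2))
        ≤ t * (4 / 3 * x * (x + 2)) := mul_le_mul_of_nonneg_left (by nlinarith) h0.le
    have a2 : t * (4 * x ^ 2 + 20 * x - 3) ≤ 1 * (4 * x ^ 2 + 20 * x - 3) :=
      mul_le_mul_of_nonneg_right h1 (by nlinarith)
    have a3 : 1 / 2 * (64 * x ^ 2 + 40 * x + 22) ≤ t ^ 2 * (64 * x ^ 2 + 40 * x + 22) :=
      mul_le_mul_of_nonneg_right ht2.le (by positivity)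
    nlinarith [sq_nonneg (x - 3 / 8)]

/-- As long as the expression inside the absolute value is nonpositive, the factor is a decreasing
cubic in `t`. -/
lemma critFactor_lt {δ s t : ℝ} (hδ : 1 ≤ δ) (hs : 1 / 2 ≤ s) (hst : s < t)
    (ht : t ^ 2 * (5 * δ ^ 4 + 2 * δ ^ 2 + 2) ≤ (2 * δ ^ 2 + 1) ^ 2) :
    critFactor δ t < critFactor δ s := by
  have hx : 1 ≤ δ ^ 2 := one_le_pow₀ hδ
  have h4 : δ ^ 4 = (δ ^ 2) ^ 2 := by ring
  rw [critFactor, critFactor]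
  rw [h4] at ht ⊢
  generalize δ ^ 2 = x at *
  have hm : 0 < 5 * x ^ 2 + 2 * x + 2 := by positivity
  have hs' : s ^ 2 * (5 * x ^ 2 + 2 * x + 2) ≤ (2 * x + 1) ^ 2 :=
    (mul_le_mul_of_nonneg_right (by gcongr) hm.le).trans ht
  rw [abs_of_nonpos (by linarith), abs_of_nonpos (by linarith)]
  have a1 : 3 / 4 ≤ s ^ 2 + s * t + t ^ 2 := by nlinarith
  have a2 : 3 / 4 * (5 * x ^ 2 + 2 * x + 2)
      ≤ (s ^ 2 + s * t + t ^ 2) * (5 * x ^ 2 + 2 * x + 2) :=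
    mul_le_mul_of_nonneg_right a1 hm.le
  have a3 : 1 * (64 * x ^ 2 + 40 * x + 22) ≤ (s + t) * (64 * x ^ 2 + 40 * x + 22) :=
    mul_le_mul_of_nonneg_right (by linarith) (by positivity)
  have a4 : 0 < -6 * (2 * x + 1) ^ 2 + 6 * ((s ^ 2 + s * t + t ^ 2) * (5 * x ^ 2 + 2 * x + 2))
      + (4 * x ^ 2 - 4 * x + 3) + (s + t) * (64 * x ^ 2 + 40 * x + 22) := by nlinarith
  have := mul_pos (sub_pos.2 hst) a4
  nlinarith

/-- The factor has exactly one zero `t₀` in the interval, and changes sign there. -/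
lemma exists_critFactor_root {δ : ℝ} (hδ : 1 ≤ δ) :
    ∃ t₀ ∈ Ioo (1 / 2 : ℝ) 1, critFactor δ t₀ = 0 ∧
      (∀ t ∈ Ioo (1 / 2 : ℝ) 1, t < t₀ → 0 < critFactor δ t) ∧
      ∀ t ∈ Ioo (1 / 2 : ℝ) 1, t₀ < t → critFactor δ t < 0 := by
  have hle : ∀ t ∈ Icc (1 / 2 : ℝ) 1, 0 ≤ critFactor δ t →
      t ^ 2 * (5 * δ ^ 4 + 2 * δ ^ 2 + 2) ≤ (2 * δ ^ 2 + 1) ^ 2 := by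
    intro t ht h
    by_contra hc
    refine h.not_gt (critFactor_neg hδ (by linarith [ht.1]) ht.2 ?_)
    have : 0 ≤ 12 * δ ^ 2 * (δ ^ 2 + 2) := by positivity
    linarith
  have hcont : ContinuousOn (critFactor δ) (Icc (1 / 2) 1) := by
    unfold critFactor
    fun_prop
  have h1 : critFactor δ 1 < 0 := by
    refine critFactor_neg hδ one_pos le_rfl ?_
    nlinarith [one_le_pow₀ hδ (n := 2)]
  obtain ⟨t₀, ht₀, hz⟩ := intermediate_value_Ioo' (by norm_num) hcont
    ⟨h1, critFactor_half_pos hδ⟩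
  refine ⟨t₀, ht₀, hz, fun t ht hlt => ?_, fun t ht hlt => ?_⟩
  · rw [← hz]
    exact critFactor_lt hδ ht.1.le hlt (hle t₀ (Ioo_subset_Icc_self ht₀) hz.ge)
  · by_contra hc
    have := critFactor_lt hδ ht₀.1.le hlt (hle t (Ioo_subset_Icc_self ht) (not_lt.1 hc))
    linarith

/-! ### Bounding the Hankel determinant -/

/-- Here `c, A, C` and `c, B, D` stand for the moduli of the first three coefficients of the two
Schwarz functions. For fixed `c` the worst case has second coefficients of maximal size `1 - c ^ 2`:
by `A ^ 2 + B ^ 2 ≥ (A + B) ^ 2 / 2`, the terms that are not increasing in `A + B` fall short of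
their value in that case by a multiple of `4 (1 - c ^ 2) ^ 2 - (A + B) ^ 2`, and the factor is
nonnegative since `9 q ≤ 16 e`. -/
lemma second_coeff_bound {c A B C D K q e t : ℝ} (hc0 : 0 ≤ c) (hA0 : 0 ≤ A) (hB0 : 0 ≤ B)
    (hA : A ≤ 1 - c ^ 2) (hB : B ≤ 1 - c ^ 2)
    (hC : C ≤ 1 - c ^ 2 - A ^ 2 / (1 + c)) (hD : D ≤ 1 - c ^ 2 - B ^ 2 / (1 + c))
    (hK : 0 ≤ K) (hq : 0 ≤ q) (hqe : 9 * q ≤ 16 * e) :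
    c ^ 2 * K * (A + B) + 9 / 4 * q * t ^ 2 * c * (C + D) + e * t ^ 2 * (A + B) ^ 2
      ≤ 2 * c ^ 2 * (1 - c ^ 2) * K + 9 / 2 * q * t ^ 2 * c ^ 2 * (1 - c ^ 2)
        + 4 * e * t ^ 2 * (1 - c ^ 2) ^ 2 := by
  have h1c : 0 < 1 + c := by linarith
  have hS : 0 ≤ 4 * (1 - c ^ 2) ^ 2 - (A + B) ^ 2 := by nlinarith
  have h1 : c * (C + D) - 2 * c ^ 2 * (1 - c ^ 2)
      ≤ c / (2 * (1 + c)) * (4 * (1 - c ^ 2) ^ 2 - (A + B) ^ 2) := by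
    have h2 : C + D ≤ 2 * (1 - c ^ 2) - (A + B) ^ 2 / (2 * (1 + c)) := by
      have h3 : (A + B) ^ 2 / (2 * (1 + c)) ≤ A ^ 2 / (1 + c) + B ^ 2 / (1 + c) := by
        rw [← add_div, ← mul_div_mul_left (A ^ 2 + B ^ 2) (1 + c) two_ne_zero]
        gcongr
        nlinarith [sq_nonneg (A - B)]
      linarith
    refine (sub_le_sub_right (mul_le_mul_of_nonneg_left h2 hc0) _).trans_eq ?_
    field_simp
    ring
  have hc1 : c ≤ 1 := by nlinarith
  have h2 : c / (2 * (1 + c)) ≤ 1 / 4 := by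
    rw [div_le_div_iff₀ (by positivity) (by norm_num)]
    linarith
  have h3 := mul_le_mul_of_nonneg_left (h1.trans (mul_le_mul_of_nonneg_right h2 hS))
    (by positivity : 0 ≤ 9 / 4 * q * t ^ 2)
  have h4 : 0 ≤ (16 * e - 9 * q) * t ^ 2 * (4 * (1 - c ^ 2) ^ 2 - (A + B) ^ 2) :=
    mul_nonneg (mul_nonneg (by linarith) (sq_nonneg t)) hS
  have h5 : c ^ 2 * K * (A + B) ≤ c ^ 2 * K * (2 * (1 - c ^ 2)) :=
    mul_le_mul_of_nonneg_left (by linarith) (by positivity)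
  linarith

/-- The triangle inequality for the Hankel determinant, multiplied by `e * q` and written through
the coefficients of the two Schwarz functions. In the application `q = (2 δ² + 1)²`,
`e = 3 δ² (δ² + 2)`, and `m`, `n` are the combinations of these that the expansion produces. -/
lemma norm_hankel_le {q e m n t : ℝ} (hq : 0 ≤ q) (he : 0 ≤ e) (hn : 0 ≤ n)
    (hm : m = 2 * q - e) (hn' : n = 5 * q - 4 * e) (ht : 1 / 2 ≤ t) {c₁ c₂ c₃ d₂ d₃ : ℂ} :
    ‖(9 : ℂ) * (q * (t * c₁ * (t * (c₃ - d₃) / 4 + (4 * t ^ 2 - 1) * c₁ * (c₂ + d₂) / 4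
        + (2 * t ^ 3 - t) * c₁ ^ 3 + 5 / 6 * t ^ 2 * c₁ * (c₂ - d₂)))
      - e * (t ^ 2 * c₁ ^ 2 + t * (c₂ - d₂) / 3) ^ 2)‖
    ≤ 9 * t ^ 2 * |q - m * t ^ 2| * ‖c₁‖ ^ 4
      + (‖c₁‖ ^ 2 * (3 / 2 * n * t ^ 3 + 9 / 4 * q * t * (4 * t ^ 2 - 1)) * (‖c₂‖ + ‖d₂‖)
      + 9 / 4 * q * t ^ 2 * ‖c₁‖ * (‖c₃‖ + ‖d₃‖) + e * t ^ 2 * (‖c₂‖ + ‖d₂‖) ^ 2) := by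
  have ht0 : 0 ≤ t := by linarith
  have ht4 : 0 ≤ 4 * t ^ 2 - 1 := by nlinarith
  have hsplit : (9 : ℂ) * (q * (t * c₁ * (t * (c₃ - d₃) / 4 + (4 * t ^ 2 - 1) * c₁ * (c₂ + d₂) / 4
        + (2 * t ^ 3 - t) * c₁ ^ 3 + 5 / 6 * t ^ 2 * c₁ * (c₂ - d₂)))
      - e * (t ^ 2 * c₁ ^ 2 + t * (c₂ - d₂) / 3) ^ 2)
      = ((-(9 * t ^ 2 * (q - m * t ^ 2)) : ℝ) : ℂ) * c₁ ^ 4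
        + ((3 / 2 * n * t ^ 3 : ℝ) : ℂ) * (c₁ ^ 2 * (c₂ - d₂))
        + ((9 / 4 * q * t * (4 * t ^ 2 - 1) : ℝ) : ℂ) * (c₁ ^ 2 * (c₂ + d₂))
        + ((9 / 4 * q * t ^ 2 : ℝ) : ℂ) * (c₁ * (c₃ - d₃))
        - ((e * t ^ 2 : ℝ) : ℂ) * (c₂ - d₂) ^ 2 := by
    subst hm hn'
    push_cast
    ring
  rw [hsplit]
  have hr : ∀ (r : ℝ) (z : ℂ), 0 ≤ r → ‖(r : ℂ) * z‖ = r * ‖z‖ := by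
    intro r z h
    rw [norm_mul, Complex.norm_of_nonneg h]
  have h0 : ‖((-(9 * t ^ 2 * (q - m * t ^ 2)) : ℝ) : ℂ) * c₁ ^ 4‖
      = 9 * t ^ 2 * |q - m * t ^ 2| * ‖c₁‖ ^ 4 := by
    rw [norm_mul, Complex.norm_real, Real.norm_eq_abs, abs_neg, abs_mul, norm_pow,
      abs_of_nonneg (by positivity : 0 ≤ 9 * t ^ 2)]
  have hsub : ‖c₂ - d₂‖ ≤ ‖c₂‖ + ‖d₂‖ := norm_sub_le _ _
  have hadd : ‖c₂ + d₂‖ ≤ ‖c₂‖ + ‖d₂‖ := norm_add_le _ _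
  have hsub3 : ‖c₃ - d₃‖ ≤ ‖c₃‖ + ‖d₃‖ := norm_sub_le _ _
  refine (norm_sub_le _ _).trans ((add_le_add_left (norm_add₄_le) _).trans ?_)
  rw [h0, hr _ _ (by positivity), hr _ _ (by positivity), hr _ _ (by positivity),
    hr _ _ (by positivity), norm_mul, norm_mul, norm_mul, norm_pow, norm_pow]
  have k1 : 3 / 2 * n * t ^ 3 * (‖c₁‖ ^ 2 * ‖c₂ - d₂‖)
      ≤ 3 / 2 * n * t ^ 3 * (‖c₁‖ ^ 2 * (‖c₂‖ + ‖d₂‖)) := by gcongr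
  have k2 : 9 / 4 * q * t * (4 * t ^ 2 - 1) * (‖c₁‖ ^ 2 * ‖c₂ + d₂‖)
      ≤ 9 / 4 * q * t * (4 * t ^ 2 - 1) * (‖c₁‖ ^ 2 * (‖c₂‖ + ‖d₂‖)) := by gcongr
  have k3 : 9 / 4 * q * t ^ 2 * (‖c₁‖ * ‖c₃ - d₃‖)
      ≤ 9 / 4 * q * t ^ 2 * (‖c₁‖ * (‖c₃‖ + ‖d₃‖)) := by gcongr
  have k4 : e * t ^ 2 * ‖c₂ - d₂‖ ^ 2 ≤ e * t ^ 2 * (‖c₂‖ + ‖d₂‖) ^ 2 := by gcongr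
  linarith

/-- The quadratic in `p = ‖c₁‖ ^ 2` that majorizes the determinant multiplied by `e * q`, where
`q = (2 δ² + 1)²` and `e = 3 δ² (δ² + 2)`. -/
noncomputable def majorant (δ t p : ℝ) : ℝ :=
  9 * t ^ 2 * |(2 * δ ^ 2 + 1) ^ 2 - (5 * δ ^ 4 + 2 * δ ^ 2 + 2) * t ^ 2| * p ^ 2
    + 2 * p * (1 - p) * (3 / 2 * (8 * δ ^ 4 - 4 * δ ^ 2 + 5) * t ^ 3
      + 9 / 4 * (2 * δ ^ 2 + 1) ^ 2 * t * (4 * t ^ 2 - 1))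
    + 9 / 2 * (2 * δ ^ 2 + 1) ^ 2 * t ^ 2 * p * (1 - p)
    + 4 * (3 * δ ^ 2 * (δ ^ 2 + 2)) * t ^ 2 * (1 - p) ^ 2

/-- Where the leading coefficient is nonnegative the majorant is convex, so its maximum on `[0, 1]`
is an end value, and the larger end value is the one at `p = 1`. -/
lemma majorant_le_phiTwo {δ t p : ℝ} (hδ : 1 ≤ δ) (ht : t ∈ Ioo (1 / 2 : ℝ) 1)
    (hD : 0 ≤ critFactor δ t) (hp0 : 0 ≤ p) (hp1 : p ≤ 1) :
    majorant δ t p / (3 * δ ^ 2 * (δ ^ 2 + 2) * (2 * δ ^ 2 + 1) ^ 2) ≤ phiTwo δ t := by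
  have hδ0 : 0 < δ := by linarith
  have ht0 : 0 < t := by linarith [ht.1]
  have hth : 9 * (t ^ 2 * (5 * δ ^ 4 + 2 * δ ^ 2 + 2))
      ≤ 9 * (2 * δ ^ 2 + 1) ^ 2 - 12 * δ ^ 2 * (δ ^ 2 + 2) := by
    by_contra hc
    exact hD.not_gt (critFactor_neg hδ ht0 ht.2.le (not_le.1 hc).le)
  have hpos : 0 < 12 * δ ^ 2 * (δ ^ 2 + 2) := by positivity
  have hs : t ^ 2 * (5 * δ ^ 4 + 2 * δ ^ 2 + 2) - (2 * δ ^ 2 + 1) ^ 2 ≤ 0 := by linarith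
  have hs' : 0 ≤ (2 * δ ^ 2 + 1) ^ 2 - (5 * δ ^ 4 + 2 * δ ^ 2 + 2) * t ^ 2 := by linarith
  have hphi : phiTwo δ t
      = 9 * t ^ 2 * ((2 * δ ^ 2 + 1) ^ 2 - (5 * δ ^ 4 + 2 * δ ^ 2 + 2) * t ^ 2)
        / (3 * δ ^ 2 * (δ ^ 2 + 2) * (2 * δ ^ 2 + 1) ^ 2) := by
    have : 2 * δ ^ 3 + δ = δ * (2 * δ ^ 2 + 1) := by ring
    rw [phiTwo, this]
    field_simp
    ring
  rw [hphi]
  refine div_le_div_of_nonneg_right ?_ (by positivity)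
  rw [majorant, abs_of_nonneg hs']
  rw [critFactor, abs_of_nonpos hs] at hD
  have h1 : 0 ≤ p * (1 - p) * (3 / 2 * t) * (3 * (2 * δ ^ 2 + 1) ^ 2
      + t * (-4 * δ ^ 4 + 4 * δ ^ 2 - 3) - t ^ 2 * (64 * δ ^ 4 + 40 * δ ^ 2 + 22)
      + 6 * t * -(t ^ 2 * (5 * δ ^ 4 + 2 * δ ^ 2 + 2) - (2 * δ ^ 2 + 1) ^ 2)) := by
    have : 0 ≤ 1 - p := by linarith
    positivity
  have h2 : 0 ≤ (1 - p) * t ^ 2 * (9 * (2 * δ ^ 2 + 1) ^ 2 - 12 * δ ^ 2 * (δ ^ 2 + 2)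
      - 9 * (t ^ 2 * (5 * δ ^ 4 + 2 * δ ^ 2 + 2))) :=
    mul_nonneg (mul_nonneg (by linarith) (sq_nonneg t)) (by linarith)
  linarith

/-- Where the leading coefficient is negative the majorant is concave, and `phiCrit` is its value
at the vertex. -/
lemma majorant_le_phiCrit {δ t p : ℝ} (hδ : 1 ≤ δ) (ht : 0 < t)
    (hD : critFactor δ t < 0) :
    majorant δ t p / (3 * δ ^ 2 * (δ ^ 2 + 2) * (2 * δ ^ 2 + 1) ^ 2) ≤ phiCrit δ t := by
  have hδ0 : 0 < δ := by linarith
  set N := 3 * (2 * δ ^ 2 + 1) ^ 2 + t * (4 * δ ^ 4 + 20 * δ ^ 2 - 3)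
    - t ^ 2 * (64 * δ ^ 4 + 40 * δ ^ 2 + 22) with hN
  have hphi : phiCrit δ t = (12 * δ ^ 2 * (δ ^ 2 + 2) * t ^ 2
        - 3 / 8 * t * (N ^ 2 / critFactor δ t))
      / (3 * δ ^ 2 * (δ ^ 2 + 2) * (2 * δ ^ 2 + 1) ^ 2) := by
    have h : δ ^ 3 + 2 * δ = δ * (δ ^ 2 + 2) := by ring
    have hne := hD.ne
    rw [phiCrit, ← hN, h, ← critFactor]
    field_simp
    ring
  have hmaj : majorant δ t p = 12 * δ ^ 2 * (δ ^ 2 + 2) * t ^ 2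
      + 3 / 2 * t * (critFactor δ t * p ^ 2 - N * p) := by
    rw [majorant, critFactor, abs_sub_comm, mul_comm (5 * δ ^ 4 + 2 * δ ^ 2 + 2) (t ^ 2), hN]
    ring
  rw [hphi, hmaj]
  refine div_le_div_of_nonneg_right ?_ (by positivity)
  have hsq : critFactor δ t * p ^ 2 - N * p + N ^ 2 / critFactor δ t / 4
      = (2 * critFactor δ t * p - N) ^ 2 / critFactor δ t / 4 := by
    have hne := hD.ne
    field_simp
    ring
  have : (2 * critFactor δ t * p - N) ^ 2 / critFactor δ t ≤ 0 :=
    div_nonpos_of_nonneg_of_nonpos (sq_nonneg _) hD.le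
  have h2 : t * (critFactor δ t * p ^ 2 - N * p + N ^ 2 / critFactor δ t / 4) ≤ 0 := by
    rw [hsq]
    exact mul_nonpos_of_nonneg_of_nonpos ht.le (by linarith)
  linarith

lemma norm_hankel_le_majorant {δ t : ℝ} (hδ : 1 ≤ δ) (ht : t ∈ Ioo (1 / 2 : ℝ) 1) {f : ℂ → ℂ}
    (hf : InClassA f) (hB : MemClassB t (hDelta δ f)) :
    ∃ p, 0 ≤ p ∧ p ≤ 1 ∧
      ‖taylorCoeff f 2 * taylorCoeff f 4 - taylorCoeff f 3 ^ 2‖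
        ≤ majorant δ t p / (3 * δ ^ 2 * (δ ^ 2 + 2) * (2 * δ ^ 2 + 1) ^ 2) := by
  have hδ0 : 0 < δ := by linarith
  have hx : 1 ≤ δ ^ 2 := one_le_pow₀ hδ
  obtain ⟨c, d, ⟨hc1, hc2, hc3⟩, ⟨-, hd2, hd3⟩, hdc, hA2, hA3, hA4⟩ :=
    hB.exists_schwarz (by linarith [ht.1])
  rw [hdc, norm_neg] at hd2 hd3
  obtain ⟨-, hb2, hb3, hb4⟩ := taylorCoeff_fDelta δ
  have hmul := taylorCoeff_hadamardProd hf.1 (differentiableOn_fDelta δ)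
  rw [hDelta, hmul] at hA2 hA3 hA4
  rw [hb2] at hA2
  rw [hb3] at hA3
  rw [hb4] at hA4
  have hδc : (δ : ℂ) ≠ 0 := by exact_mod_cast hδ0.ne'
  have hq0 : (2 * (δ : ℂ) ^ 2 + 1) ≠ 0 := by
    exact_mod_cast (by positivity : (2 * δ ^ 2 + 1) ≠ 0)
  have hr0 : ((δ : ℂ) ^ 2 + 2) ≠ 0 := by
    exact_mod_cast (by positivity : (δ ^ 2 + 2) ≠ 0)
  set q : ℝ := (2 * δ ^ 2 + 1) ^ 2 with hq
  set e : ℝ := 3 * δ ^ 2 * (δ ^ 2 + 2) with he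
  have hqp : 0 < q := by positivity
  have hep : 0 < e := by positivity
  have hdet : taylorCoeff f 2 * taylorCoeff f 4 - taylorCoeff f 3 ^ 2
      = (9 : ℂ) * (q * (t * c 1 * (t * (c 3 - d 3) / 4
          + (4 * t ^ 2 - 1) * c 1 * (c 2 + d 2) / 4
          + (2 * t ^ 3 - t) * c 1 ^ 3 + 5 / 6 * t ^ 2 * c 1 * (c 2 - d 2)))
        - e * (t ^ 2 * c 1 ^ 2 + t * (c 2 - d 2) / 3) ^ 2) / ((e * q : ℝ) : ℂ) := by
    rw [← hA2, ← hA3, ← hA4, hq, he]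
    push_cast
    field_simp
    ring
  have hn : 0 ≤ 8 * δ ^ 4 - 4 * δ ^ 2 + 5 := by nlinarith
  have h4t : 0 ≤ 4 * t ^ 2 - 1 := by nlinarith [ht.1]
  have ht0 : 0 < t := by linarith [ht.1]
  refine ⟨‖c 1‖ ^ 2, by positivity, pow_le_one₀ (norm_nonneg _) hc1, ?_⟩
  rw [hdet, norm_div, Complex.norm_of_nonneg (by positivity : 0 ≤ e * q)]
  refine div_le_div_of_nonneg_right ?_ (by positivity)
  have h1 := norm_hankel_le (m := 5 * δ ^ 4 + 2 * δ ^ 2 + 2) (n := 8 * δ ^ 4 - 4 * δ ^ 2 + 5)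
    hqp.le hep.le hn (by rw [hq, he]; ring) (by rw [hq, he]; ring) ht.1.le
    (c₁ := c 1) (c₂ := c 2) (c₃ := c 3) (d₂ := d 2) (d₃ := d 3)
  have h2 := second_coeff_bound (t := t) (q := q) (e := e)
    (K := 3 / 2 * (8 * δ ^ 4 - 4 * δ ^ 2 + 5) * t ^ 3 + 9 / 4 * q * t * (4 * t ^ 2 - 1))
    (norm_nonneg (c 1)) (norm_nonneg (c 2)) (norm_nonneg (d 2)) hc2 hd2 hc3 hd3
    (by positivity) hqp.le (by rw [hq, he]; nlinarith)
  rw [majorant]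
  linarith

theorem corollary3 (δ : ℝ) (hδ : 1 ≤ δ) :
    ∃ t₀ ∈ Ioo (1 / 2 : ℝ) 1,
      (∀ s ∈ Ioo (1 / 2 : ℝ) 1, chiOne 1 1 δ s = 0 ↔ s = t₀) ∧
      ∀ t ∈ Ioo (1 / 2 : ℝ) 1, ∀ f : ℂ → ℂ, InClassA f → MemClassB t (hDelta δ f) →
        (t ≤ t₀ →
          ‖taylorCoeff f 2 * taylorCoeff f 4 - taylorCoeff f 3 ^ 2‖ ≤ phiTwo δ t) ∧
        (t₀ < t →
          ‖taylorCoeff f 2 * taylorCoeff f 4 - taylorCoeff f 3 ^ 2‖ ≤ phiCrit δ t) := by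
  obtain ⟨t₀, ht₀, hz, hpos, hneg⟩ := exists_critFactor_root hδ
  refine ⟨t₀, ht₀, fun s hs => ?_, fun t ht f hf hB => ?_⟩
  · have hs0 : 0 < s := by linarith [hs.1]
    rw [chiOne_one_one δ hs0, mul_eq_zero, or_iff_right (by positivity)]
    constructor
    · intro h
      rcases lt_trichotomy s t₀ with hlt | heq | hgt
      · exact absurd h (hpos s hs hlt).ne'
      · exact heq
      · exact absurd h (hneg s hs hgt).ne
    · rintro rfl
      exact hz
  · obtain ⟨p, hp0, hp1, hle⟩ := norm_hankel_le_majorant hδ ht hf hB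
    refine ⟨fun h => hle.trans (majorant_le_phiTwo hδ ht ?_ hp0 hp1), fun h =>
      hle.trans (majorant_le_phiCrit hδ (by linarith [ht.1]) (hneg t ht h))⟩
    rcases h.lt_or_eq with hlt | rfl
    · exact (hpos t ht hlt).le
    · exact hz.ge
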